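/- **Setting.** Let $\Omega\subset\mathbb R^d$ be open. Let $V$ be a linear space of smooth functions on $\Omega$ containing the constants, let $T$ be a linear space of smooth functions on $\Omega$ with $\int\sigma\,dx=0$ for $\sigma\in T$ and $\Phi\sigma$ integrable for all $\Phi\in V,\sigma\in T$, and let $T^*=V/\mathbb R$. (For bounded $\Omega$ one may take $V$ to be all functions smooth up to the boundary and $T$ those of them with mean zero.) Let $\mathcal P$ be a set of smooth probability densities on $\Omega$. Let $T$ and $T^*$ carry vector space topologies for which $(\Phi,\sigma)\mapsto\int\Phi\sigma\,dx$ is continuous on $T^*\times T$, and let $\{\tau\in T:\rho+\tau\in\mathcal P\}$ be open in $T$ for each $\rho\in\mathcal P$. The space $T$ is the tangent space and $T^*$ the cotangent space of $\mathcal P$ at every $\rho\in\mathcal P$. The first variation $\frac{\delta F}{\delta\rho}(\rho)\in T^*$ of a functional $F$ on $\mathcal P$ is defined by $\frac{d}{d\varepsilon}\big|_{\varepsilon=0}F(\rho+\varepsilon\sigma)=\int\frac{\delta F}{\delta\rho}\,\sigma\,dx$ for all $\sigma\in T$. *Metric.* For each $\rho\in\mathcal P$ let $G(\rho):T\to T^*$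 be a linear bijection such that $g_\rho(\sigma_1,\sigma_2)=\int\sigma_1G(\rho)\sigma_2\,dx$ is an inner product on $T$. Assume that $\rho\mapsto\int\Phi_1G(\rho)^{-1}\Phi_2\,dx$ has a first variation $$\mathcal A(\rho)(\Phi_1,\Phi_2)=\frac{\delta}{\delta\rho}\int\Phi_1G(\rho)^{-1}\Phi_2\,dx\in T^*$$ for all $\rho\in\mathcal P$ and $\Phi_1,\Phi_2\in T^*$, and that $G(\rho)^{-1}\Phi$ and $\mathcal A(\rho)(\Phi_1,\Phi_2)$ depend jointly continuously on their arguments. *Energy.* Let $E:\mathcal P\to\mathbb R$ have a first variation $\frac{\delta E}{\delta\rho}$ at every $\rho\in\mathcal P$, and a second variation, i.e. a (possibly distributional) kernel $\frac{\delta^2E}{\delta\rho^2}(x,y)$ acting on $\sigma\in T$ by $\int\frac{\delta^2E}{\delta\rho^2}(x,\cdot)\,\sigma(x)\,dx=\frac{\delta}{\delta\rho}\int\frac{\delta E}{\delta\rho}(x)\,\sigma(x)\,dx\in T^*$, and let $\frac{\delta E}{\delta\rho}$ and this element depend continuously on $\rho$ and on $(\rho,\sigma)$ respectively. *Geodesics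 and Hessians.* A geodesic with initial point $\rho$ and initial velocity $\sigma$ is a curve $\hat\rho_s$ in $\mathcal P$, $s$ near $0$, with $\hat\rho_0=\rho$, $\partial_s\hat\rho_s|_{s=0}=\sigma$, such that for some curve $\Phi_s$ in $T^*$ $$\partial_s\hat\rho_s=G(\hat\rho_s)^{-1}\Phi_s,\qquad \partial_s\Phi_s+\tfrac12\frac{\delta}{\delta\hat\rho_s}\int\Phi_sG(\hat\rho_s)^{-1}\Phi_s\,dx=0 .$$ The Hessian operator $\operatorname{Hess}E(\rho):T\to T$ is a linear operator, self-adjoint for $g_\rho$, with $g_\rho(\sigma,\operatorname{Hess}E(\rho)\sigma)=\frac{d^2}{ds^2}\big|_{s=0}E(\hat\rho_s)$ for all geodesics $\hat\rho_s$ with initial point $\rho$ and initial velocity $\sigma$, for all $\sigma\in T$. The operator $\mathcal H_E(\rho):T^*\to T$ is the linear operator, self-adjoint for the pairing, with $\int\Phi\,\mathcal H_E(\rho)\Phi\,dx=g_\rho(\sigma,\operatorname{Hess}E(\rho)\sigma)$ whenever $\Phi=G(\rho)\sigma$. **Proposition.** Let $\rho\in\mathcal P$. 1. $\mathcal A(\rho):T^*\times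 T^*\to T^*$ is bilinear. 2. For $\Phi\in T^*$ put $$Q_\rho(\Phi)=-\frac12\int\mathcal A(\rho)(\Phi,\Phi)\,G(\rho)^{-1}\frac{\delta E}{\delta\rho}\,dx+\int\mathcal A(\rho)\Big(\Phi,\frac{\delta E}{\delta\rho}\Big)G(\rho)^{-1}\Phi\,dx+\iint\big(G(\rho)^{-1}\Phi\big)(y)\,\frac{\delta^2E}{\delta\rho^2}(x,y)\,dy\,\big(G(\rho)^{-1}\Phi\big)(x)\,dx .$$ For every geodesic $\hat\rho_s$ with initial point $\rho$ and initial velocity $\sigma$, $E(\hat\rho_s)$ is differentiable near $s=0$ and twice differentiable at $s=0$, with $\frac{d^2}{ds^2}\big|_{s=0}E(\hat\rho_s)=Q_\rho(G(\rho)\sigma)$. 3. Suppose that for every $\sigma\in T$ there is a geodesic with initial point $\rho$ and initial velocity $\sigma$, and that $\operatorname{Hess}E(\rho)$ is a Hessian operator of $E$ at $\rho$. Then there is exactly one operator $\mathcal H_E(\rho)$ as above, and for all $\sigma\in T$ and $\Phi=G(\rho)\sigma$ $$\int\Phi\,\mathcal H_E(\rho)\Phi\,dx=g_\rho(\sigma,\operatorname{Hess}E(\rho)\sigma)=Q_\rho(\Phi).$$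 Moreover $\mathcal H_E(\rho)=\operatorname{Hess}E(\rho)\,G(\rho)^{-1}$. -/

import Mathlib

open MeasureTheory Filter Topology
open scoped ContDiff

/-- A real function on the open set `Ω` is smooth if its extension by zero is `C^∞` on `Ω`. -/
def IsSmoothFun {d : ℕ} {Ω : Set (EuclideanSpace ℝ (Fin d))}
    (f : Ω → ℝ) : Prop :=
  ContDiffOn ℝ ∞ (Function.extend Subtype.val f 0) Ω

/-- Lebesgue measure on the subset `Ω` of `ℝ^d`. -/
noncomputable def lebesgueOn {d : ℕ} (Ω : Set (EuclideanSpace ℝ (Fin d))) : Measure Ω :=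
  Measure.comap Subtype.val volume

/-- A probability space of smooth densities on a sample region `Ω ⊆ ℝ^d`, with the class of smooth
mean-zero functions used as tangent vectors and the class of smooth functions used as
potentials (representatives of cotangent vectors).  The only requirements are those under which
the integrals `∫ Φ σ dx` make sense.  For a bounded region one can take all functions smooth up to
the boundary for the potentials, and those of mean zero for the tangent vectors. -/
structure DensitySpace (d : ℕ) where
  /-- the sample space -/
  Ω : Set (EuclideanSpace ℝ (Fin d))
  /-- the probability densities under consideration -/
  densities : Set (Ω → ℝ)
  /-- the tangent vectors, as functions -/
  tangent : Submodule ℝ (Ω → ℝ)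
  /-- the potentials; cotangent vectors are potentials up to additive constants -/
  potential : Submodule ℝ (Ω → ℝ)
  isOpen_Ω : IsOpen Ω
  density_smooth : ∀ ρ ∈ densities, IsSmoothFun ρ
  density_nonneg : ∀ ρ ∈ densities, ∀ x, 0 ≤ ρ x
  density_integrable : ∀ ρ ∈ densities, Integrable ρ (lebesgueOn Ω)
  density_integral : ∀ ρ ∈ densities, ∫ x, ρ x ∂(lebesgueOn Ω) = 1
  tangent_smooth : ∀ σ ∈ tangent, IsSmoothFun σ
  tangent_integral : ∀ σ ∈ tangent, ∫ x, σ x ∂(lebesgueOn Ω) = 0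
  potential_smooth : ∀ Φ ∈ potential, IsSmoothFun Φ
  one_mem : (fun _ => (1 : ℝ)) ∈ potential
  integrable_mul : ∀ Φ ∈ potential, ∀ σ ∈ tangent, Integrable (fun x => Φ x * σ x) (lebesgueOn Ω)

noncomputable section

namespace DensitySpace

variable {d : ℕ} (X : DensitySpace d)

/-- The tangent space (the same at every density). -/
def Tangent : Type := X.tangent

instance : AddCommGroup X.Tangent := inferInstanceAs (AddCommGroup X.tangent)
instance : Module ℝ X.Tangent := inferInstanceAs (Module ℝ X.tangent)

/-- The constant functions among the potentials. -/
def constants : Submodule ℝ X.potential := Submodule.span ℝ {⟨fun _ => 1, X.one_mem⟩}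

/-- The cotangent space: potentials up to additive constants. -/
def Cotangent : Type := X.potential ⧸ X.constants

instance : AddCommGroup X.Cotangent := inferInstanceAs (AddCommGroup (X.potential ⧸ X.constants))
instance : Module ℝ X.Cotangent := inferInstanceAs (Module ℝ (X.potential ⧸ X.constants))

/-- The class of a potential modulo constants. -/
def mkCotangent : X.potential →ₗ[ℝ] X.Cotangent := X.constants.mkQ

/-- `∫ Φ σ dx` for a potential `Φ` and a tangent vector `σ`. -/
def prePairing : X.potential →ₗ[ℝ] X.tangent →ₗ[ℝ] ℝ :=
  LinearMap.mk₂ ℝ (fun (Φ : X.potential) (σ : X.tangent) => ∫ x, Φ.1 x * σ.1 x ∂(lebesgueOn X.Ω))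
    (fun Φ Ψ σ => by
      simp only [Submodule.coe_add, Pi.add_apply, add_mul]
      exact integral_add (X.integrable_mul _ Φ.2 _ σ.2) (X.integrable_mul _ Ψ.2 _ σ.2))
    (fun c Φ σ => by
      simp only [Submodule.coe_smul, Pi.smul_apply, smul_eq_mul, mul_assoc]
      exact integral_const_mul _ _)
    (fun Φ σ τ => by
      simp only [Submodule.coe_add, Pi.add_apply, mul_add]
      exact integral_add (X.integrable_mul _ Φ.2 _ σ.2) (X.integrable_mul _ Φ.2 _ τ.2))
    (fun c Φ σ => by
      simp only [Submodule.coe_smul, Pi.smul_apply, smul_eq_mul, mul_left_comm _ c]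
      exact integral_const_mul _ _)

/-- The `L²` pairing `∫ Φ σ dx` of a cotangent vector with a tangent vector; it is well defined
modulo constants because tangent vectors have mean zero. -/
def pairing : X.Cotangent →ₗ[ℝ] X.Tangent →ₗ[ℝ] ℝ :=
  X.constants.liftQ X.prePairing (by
    refine (Submodule.span_singleton_le_iff_mem _ _).2 (LinearMap.mem_ker.2 ?_)
    ext σ
    have h : ∫ x, (1 : ℝ) * σ.1 x ∂(lebesgueOn X.Ω) = 0 := by simpa using X.tangent_integral _ σ.2
    exact h)

theorem pairing_mk (Φ : X.potential) (σ : X.Tangent) :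
    X.pairing (X.mkCotangent Φ) σ = ∫ x, Φ.1 x * σ.1 x ∂(lebesgueOn X.Ω) := rfl

/-- The function `ρ + σ` for a tangent vector `σ`. -/
def shift (ρ : X.Ω → ℝ) (σ : X.Tangent) : X.Ω → ℝ := ρ + σ.1

variable {X}

/-- `Φ` is the `L²` first variation `δF/δρ` of the functional `F` at `ρ`:
`d/dε F(ρ + ε σ) = ∫ Φ σ dx` at `ε = 0`, for all tangent vectors `σ`. -/
def HasFirstVariationAt (F : (X.Ω → ℝ) → ℝ) (Φ : X.Cotangent) (ρ : X.Ω → ℝ) : Prop :=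
  ∀ σ : X.Tangent, HasDerivAt (fun ε : ℝ => F (X.shift ρ (ε • σ))) (X.pairing Φ σ) 0

/-- A metric tensor: at each density an invertible linear map from the tangent space to the
cotangent space for which `(σ₁, σ₂) ↦ ∫ σ₁ G(ρ)σ₂ dx` is an inner product.  (The values of `G`
at functions that are not among the densities play no role.) -/
structure IsMetricTensor (G : (X.Ω → ℝ) → X.Tangent ≃ₗ[ℝ] X.Cotangent) : Prop where
  symm : ∀ ρ ∈ X.densities, ∀ σ τ : X.Tangent, X.pairing (G ρ σ) τ = X.pairing (G ρ τ) σ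
  pos : ∀ ρ ∈ X.densities, ∀ σ : X.Tangent, σ ≠ 0 → 0 < X.pairing (G ρ σ) σ

/-- The inner product `g_ρ(σ, τ) = ∫ σ G(ρ)τ dx`. -/
def metric (G : (X.Ω → ℝ) → X.Tangent ≃ₗ[ℝ] X.Cotangent) (ρ : X.Ω → ℝ) (σ τ : X.Tangent) : ℝ :=
  X.pairing (G ρ τ) σ

/-- `A(ρ)(Φ₁, Φ₂)` is the first variation of `ρ ↦ ∫ Φ₁ G(ρ)⁻¹ Φ₂ dx`, for all densities `ρ` and all
cotangent vectors `Φ₁`, `Φ₂`. -/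
def IsMetricVariation (G : (X.Ω → ℝ) → X.Tangent ≃ₗ[ℝ] X.Cotangent)
    (A : (X.Ω → ℝ) → X.Cotangent → X.Cotangent → X.Cotangent) : Prop :=
  ∀ ρ ∈ X.densities, ∀ Φ₁ Φ₂ : X.Cotangent,
    HasFirstVariationAt (fun ρ' => X.pairing Φ₁ ((G ρ').symm Φ₂)) (A ρ Φ₁ Φ₂) ρ

/-- `D ρ` is the first variation `δE/δρ` of `E` at every density `ρ`. -/
def IsFirstVariation (E : (X.Ω → ℝ) → ℝ) (D : (X.Ω → ℝ) → X.Cotangent) : Prop :=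
  ∀ ρ ∈ X.densities, HasFirstVariationAt E (D ρ) ρ

/-- `S` is the second variation of the functional with first variation `D`.  The (in general
distributional) kernel `δ²E/δρ²(x, y)`, the first variation of `ρ ↦ (δE/δρ)(x)`, is represented by
its action `S ρ σ = ∫ δ²E/δρ²(x, ·) σ(x) dx` on tangent vectors: `S ρ σ` is the first variation of
`ρ ↦ ∫ δE/δρ(x) σ(x) dx`.  In particular
`∫∫ σ(y) δ²E/δρ²(x, y) dy σ(x) dx = X.pairing (S ρ σ) σ`. -/
def IsSecondVariation (D : (X.Ω → ℝ) → X.Cotangent)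
    (S : (X.Ω → ℝ) → X.Tangent →ₗ[ℝ] X.Cotangent) : Prop :=
  ∀ ρ ∈ X.densities, ∀ σ : X.Tangent,
    HasFirstVariationAt (fun ρ' => X.pairing (D ρ') σ) (S ρ σ) ρ

section Calculus

variable [TopologicalSpace X.Tangent] [TopologicalSpace X.Cotangent]

variable (X) in
/-- The tangent and cotangent topologies fit the density space: the pairing is continuous, and the
densities near a density `ρ` in `ρ + Tangent` form an open set. -/
structure IsOpenDensitySpace : Prop where
  continuous_pairing : Continuous (fun p : X.Cotangent × X.Tangent => X.pairing p.1 p.2)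
  isOpen : ∀ ρ ∈ X.densities, IsOpen {τ : X.Tangent | X.shift ρ τ ∈ X.densities}

/-- `G(ρ)⁻¹ Φ` and `A(ρ)(Φ₁, Φ₂)` depend continuously on all their arguments. -/
structure IsC1Metric (G : (X.Ω → ℝ) → X.Tangent ≃ₗ[ℝ] X.Cotangent)
    (A : (X.Ω → ℝ) → X.Cotangent → X.Cotangent → X.Cotangent) : Prop where
  continuous_inv : ∀ ρ ∈ X.densities, ∀ Φ : X.Cotangent,
    ContinuousAt (fun p : X.Tangent × X.Cotangent => (G (X.shift ρ p.1)).symm p.2) (0, Φ)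
  continuous_variation : ∀ ρ ∈ X.densities, ∀ Φ₁ Φ₂ : X.Cotangent,
    ContinuousAt (fun p : X.Tangent × X.Cotangent × X.Cotangent =>
      A (X.shift ρ p.1) p.2.1 p.2.2) (0, Φ₁, Φ₂)

/-- The first variation `D ρ` and the second variation `S ρ σ` depend continuously on all their
arguments. -/
structure IsC2Functional (D : (X.Ω → ℝ) → X.Cotangent)
    (S : (X.Ω → ℝ) → X.Tangent →ₗ[ℝ] X.Cotangent) : Prop where
  continuous_first : ∀ ρ ∈ X.densities,
    ContinuousAt (fun τ : X.Tangent => D (X.shift ρ τ)) 0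
  continuous_second : ∀ ρ ∈ X.densities, ∀ σ : X.Tangent,
    ContinuousAt (fun p : X.Tangent × X.Tangent => S (X.shift ρ p.1) p.2) (0, σ)

variable [ContinuousSMul ℝ X.Tangent] [ContinuousSMul ℝ X.Cotangent]

/-- The curve `s ↦ ρ + c s` is a geodesic with initial point `ρ` and initial velocity `σ`: for some
curve `Φ s` of cotangent vectors and all `s` near `0`,
`∂ₛ ρₛ = G(ρₛ)⁻¹ Φₛ` and `∂ₛ Φₛ + ½ δ/δρₛ (∫ Φₛ G(ρₛ)⁻¹ Φₛ dx) = 0`. -/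
def IsGeodesicFrom (G : (X.Ω → ℝ) → X.Tangent ≃ₗ[ℝ] X.Cotangent) (ρ : X.Ω → ℝ) (σ : X.Tangent)
    (c : ℝ → X.Tangent) : Prop :=
  c 0 = 0 ∧ HasDerivAt c σ 0 ∧
  ∃ Φ : ℝ → X.Cotangent, ∀ᶠ s in 𝓝 (0 : ℝ),
    X.shift ρ (c s) ∈ X.densities ∧
    HasDerivAt c ((G (X.shift ρ (c s))).symm (Φ s)) s ∧
    ∃ B : X.Cotangent,
      HasFirstVariationAt (fun ρ' => X.pairing (Φ s) ((G ρ').symm (Φ s))) B (X.shift ρ (c s)) ∧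
      HasDerivAt Φ (-((1 / 2 : ℝ) • B)) s

/-- `f` is differentiable near `0`, and its second derivative at `0` exists and equals `v`. -/
def HasSecondDerivAtZero (f : ℝ → ℝ) (v : ℝ) : Prop :=
  (∀ᶠ s in 𝓝 (0 : ℝ), DifferentiableAt ℝ f s) ∧ HasDerivAt (deriv f) v 0

/-- `L` is the Hessian operator `Hess E(ρ)`: it is self-adjoint for the metric, and
`g_ρ(σ, L σ) = d²/ds² E(ρₛ)` at `s = 0` for the geodesics `ρₛ` from `ρ` with initial
velocity `σ`. -/
structure IsHessian (G : (X.Ω → ℝ) → X.Tangent ≃ₗ[ℝ] X.Cotangent) (E : (X.Ω → ℝ) → ℝ)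
    (ρ : X.Ω → ℝ) (L : X.Tangent →ₗ[ℝ] X.Tangent) : Prop where
  selfAdjoint : ∀ σ τ : X.Tangent, metric G ρ (L σ) τ = metric G ρ σ (L τ)
  secondDeriv : ∀ (σ : X.Tangent) (c : ℝ → X.Tangent), IsGeodesicFrom G ρ σ c →
    HasSecondDerivAtZero (fun s => E (X.shift ρ (c s))) (metric G ρ σ (L σ))

end Calculus

/-- `H` is the operator `𝓗_E(ρ)` from the cotangent to the tangent space attached to the Hessian
operator `L`: it is self-adjoint, and `∫ Φ (H Φ) dx = g_ρ(σ, L σ)` whenever `Φ = G(ρ)σ`. -/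
structure IsCotangentHessian (G : (X.Ω → ℝ) → X.Tangent ≃ₗ[ℝ] X.Cotangent) (ρ : X.Ω → ℝ)
    (L : X.Tangent →ₗ[ℝ] X.Tangent) (H : X.Cotangent →ₗ[ℝ] X.Tangent) : Prop where
  selfAdjoint : ∀ Φ Ψ : X.Cotangent, X.pairing Φ (H Ψ) = X.pairing Ψ (H Φ)
  quadratic : ∀ (σ : X.Tangent) (Φ : X.Cotangent), Φ = G ρ σ →
    X.pairing Φ (H Φ) = metric G ρ σ (L σ)

/-- The explicit expression
`-½ ∫ A(ρ)(Φ,Φ) G(ρ)⁻¹ δE/δρ dx + ∫ A(ρ)(Φ, δE/δρ) G(ρ)⁻¹Φ dx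
  + ∫∫ (G(ρ)⁻¹Φ)(y) δ²E/δρ²(x,y) dy (G(ρ)⁻¹Φ)(x) dx`. -/
def hessianFormula (G : (X.Ω → ℝ) → X.Tangent ≃ₗ[ℝ] X.Cotangent)
    (A : (X.Ω → ℝ) → X.Cotangent → X.Cotangent → X.Cotangent)
    (D : (X.Ω → ℝ) → X.Cotangent) (S : (X.Ω → ℝ) → X.Tangent →ₗ[ℝ] X.Cotangent)
    (ρ : X.Ω → ℝ) (Φ : X.Cotangent) : ℝ :=
  -(1 / 2) * X.pairing (A ρ Φ Φ) ((G ρ).symm (D ρ))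
    + X.pairing (A ρ Φ (D ρ)) ((G ρ).symm Φ)
    + X.pairing (S ρ ((G ρ).symm Φ)) ((G ρ).symm Φ)

end DensitySpace

end

/-! Along a geodesic, the chain rule gives `d/ds E = ∫ D(ρₛ) G(ρₛ)⁻¹Φₛ`. Differentiating again at
`0`, one varies `D`, then `G⁻¹`, then `Φₛ`. The first two changes produce the `S` term and `∫
A(ρ)(D, Φ) G⁻¹Φ`; the third, through `∂ₛΦ = -½ A(Φ, Φ)` and the symmetry of `G`, produces the `-½`
term.

First variations are only directional, and the spaces carry no norm. Both derivatives therefore rest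
on `tendsto_mul_sub`: the mean value theorem on the segment from `ρ` to `ρ + h` writes an increment
as a pairing at an intermediate point, and continuity of the first variation and of the pairing
gives the limit.

Positivity of the metric makes the pairing nondegenerate, so first variations are unique. This
yields the bilinearity and symmetry of `A`, and, with polarization, the uniqueness of `𝓗_E(ρ)`. -/

theorem HasDerivAt.tendsto_inv_smul_sub {V : Type*} [AddCommGroup V] [Module ℝ V]
    [TopologicalSpace V] [IsTopologicalAddGroup V] [ContinuousSMul ℝ V] {f : ℝ → V} {f' : V}
    {x : ℝ} (h : HasDerivAt f f' x) :
    Tendsto (fun y => (y - x)⁻¹ • (f y - f x)) (𝓝[≠] x) (𝓝 f') := by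
  have h1 := ((hasDerivAt_iff_hasFDerivAt.1 h).isLittleOTVS.tendsto_inv_smul.mono_left
    (nhdsWithin_le_nhds (s := {x}ᶜ))).add_const f'
  rw [zero_add] at h1
  refine h1.congr' ?_
  filter_upwards [self_mem_nhdsWithin] with y hy
  have hy' : y - x ≠ 0 := sub_ne_zero.2 hy
  rw [ContinuousLinearMap.toSpanSingleton_apply, smul_sub _ (f y - f x), inv_smul_smul₀ hy',
    sub_add_cancel]

theorem HasDerivAt.tendsto_sub_nhdsNE {V : Type*} [AddCommGroup V] [Module ℝ V]
    [TopologicalSpace V] [IsTopologicalAddGroup V] [ContinuousSMul ℝ V] {f : ℝ → V} {f' : V}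
    {x : ℝ} (h : HasDerivAt f f' x) :
    Tendsto (fun y => f y - f x) (𝓝[≠] x) (𝓝 0) := by
  have h0 : Tendsto (fun y => y - x) (𝓝[≠] x) (𝓝 0) := by
    have : Tendsto (fun y : ℝ => y - x) (𝓝 x) (𝓝 (x - x)) := tendsto_id.sub_const x
    rw [sub_self] at this
    exact this.mono_left nhdsWithin_le_nhds
  have h1 := h0.smul h.tendsto_inv_smul_sub
  rw [zero_smul] at h1
  refine h1.congr' ?_
  filter_upwards [self_mem_nhdsWithin] with y hy
  exact smul_inv_smul₀ (sub_ne_zero.2 hy) _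

/-- Balanced neighbourhoods of zero absorb factors in `[0, 1]`, however these depend on `i`. This
controls the intermediate points of the mean value theorem without local convexity. -/
theorem Filter.Tendsto.smul_zero_of_mem_Icc {ι V : Type*} [AddCommGroup V] [Module ℝ V]
    [TopologicalSpace V] [ContinuousSMul ℝ V] {l : Filter ι} {h : ι → V}
    {θ : ι → ℝ} (hh : Tendsto h l (𝓝 0)) (hθ : ∀ i, θ i ∈ Set.Icc (0 : ℝ) 1) :
    Tendsto (fun i => θ i • h i) l (𝓝 0) := by
  refine (nhds_basis_balanced ℝ V).tendsto_right_iff.2 fun U hU => ?_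
  filter_upwards [hh hU.1] with i hi
  exact hU.2.smul_mem (by rw [Real.norm_of_nonneg (hθ i).1]; exact (hθ i).2) hi

/-! ### Mean value theorem and chain rule for first variations -/

namespace DensitySpace

variable {d : ℕ} {X : DensitySpace d}

theorem shift_zero (ρ : X.Ω → ℝ) : X.shift ρ 0 = ρ := add_zero ρ

theorem shift_shift (ρ : X.Ω → ℝ) (σ τ : X.Tangent) :
    X.shift (X.shift ρ σ) τ = X.shift ρ (σ + τ) := add_assoc ρ σ.1 τ.1

theorem shift_shift_sub (ρ : X.Ω → ℝ) (σ τ : X.Tangent) :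
    X.shift (X.shift ρ σ) (τ - σ) = X.shift ρ τ := by
  rw [shift_shift, add_sub_cancel]

/-- The mean value theorem for functionals with a first variation. -/
theorem exists_sub_eq_pairing {F : (X.Ω → ℝ) → ℝ} {K : (X.Ω → ℝ) → X.Cotangent}
    (hF : IsFirstVariation F K) {ρ : X.Ω → ℝ} {h : X.Tangent}
    (hseg : ∀ t ∈ Set.Icc (0 : ℝ) 1, X.shift ρ (t • h) ∈ X.densities) :
    ∃ t ∈ Set.Icc (0 : ℝ) 1,
      F (X.shift ρ h) - F ρ = X.pairing (K (X.shift ρ (t • h))) h := by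
  have hd : ∀ t ∈ Set.Icc (0 : ℝ) 1, HasDerivAt (fun s : ℝ => F (X.shift ρ (s • h)))
      (X.pairing (K (X.shift ρ (t • h))) h) t := by
    intro t ht
    have h1 := hF _ (hseg t ht) h
    -- Writing `0` as `t - t` turns the derivative at `0` based at `ρ + t h` into the derivative at
    -- `t` based at `ρ`.
    rw [← sub_self t] at h1
    have h2 := h1.comp_sub_const t t
    refine h2.congr_of_eventuallyEq (Eventually.of_forall fun s => ?_)
    simp only [shift_shift, ← add_smul, add_sub_cancel]
  obtain ⟨t, ht, he⟩ := exists_hasDerivAt_eq_slope (fun s : ℝ => F (X.shift ρ (s • h)))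
    (fun t => X.pairing (K (X.shift ρ (t • h))) h) one_pos
    (fun t ht => (hd t ht).continuousAt.continuousWithinAt)
    (fun t ht => hd t (Set.Ioo_subset_Icc_self ht))
  refine ⟨t, Set.Ioo_subset_Icc_self ht, ?_⟩
  rw [he, one_smul, zero_smul, shift_zero, sub_zero, div_one]

section Calculus

variable [TopologicalSpace X.Tangent] [TopologicalSpace X.Cotangent]
  [ContinuousSMul ℝ X.Tangent]

/-- Difference quotients of a family of functionals along increments `h i` tending to zero converge
to the pairing of the limits of the first variations and of the rescaled increments. -/
theorem tendsto_mul_sub (hX : X.IsOpenDensitySpace) {ι : Type*} {l : Filter ι}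
    {F : ι → (X.Ω → ℝ) → ℝ} {K : ι → (X.Ω → ℝ) → X.Cotangent}
    (hF : ∀ i, IsFirstVariation (F i) (K i)) {ρ : X.Ω → ℝ} (hρ : ρ ∈ X.densities)
    {h : ι → X.Tangent} {r : ι → ℝ} {σ : X.Tangent} {k : X.Cotangent}
    (hh : Tendsto h l (𝓝 0)) (hr : Tendsto (fun i => r i • h i) l (𝓝 σ))
    (hK : Tendsto (fun q : X.Tangent × ι => K q.2 (X.shift ρ q.1)) (𝓝 0 ×ˢ l) (𝓝 k)) :
    Tendsto (fun i => r i * (F i (X.shift ρ (h i)) - F i ρ)) l (𝓝 (X.pairing k σ)) := by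
  have hU : {τ : X.Tangent | X.shift ρ τ ∈ X.densities} ∈ 𝓝 (0 : X.Tangent) :=
    (hX.isOpen ρ hρ).mem_nhds (by simpa [shift_zero] using hρ)
  obtain ⟨W, hW, hWU⟩ := (nhds_basis_balanced ℝ X.Tangent).mem_iff.1 hU
  -- As `W` is balanced, `h i ∈ W` puts the whole segment among the densities. Otherwise the dummy
  -- value `0` keeps `θ i` in `[0, 1]` for every `i`.
  have hex : ∀ i, ∃ t ∈ Set.Icc (0 : ℝ) 1, h i ∈ W →
      F i (X.shift ρ (h i)) - F i ρ = X.pairing (K i (X.shift ρ (t • h i))) (h i) := by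
    intro i
    by_cases hi : h i ∈ W
    · obtain ⟨t, ht, he⟩ := exists_sub_eq_pairing (hF i) (ρ := ρ) (h := h i) fun t ht =>
        hWU (hW.2.smul_mem (by rw [Real.norm_of_nonneg ht.1]; exact ht.2) hi)
      exact ⟨t, ht, fun _ => he⟩
    · exact ⟨0, by simp, fun h => absurd h hi⟩
  choose θ hθ he using hex
  have hKθ := hK.comp ((hh.smul_zero_of_mem_Icc hθ).prodMk tendsto_id)
  have hlim := (hX.continuous_pairing.tendsto (k, σ)).comp (hKθ.prodMk_nhds hr)
  refine hlim.congr' ?_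
  filter_upwards [hh hW.1] with i hi
  rw [he i hi]
  simp

/-- The chain rule along a differentiable curve of densities. -/
theorem hasDerivAt_comp_shift [IsTopologicalAddGroup X.Tangent] (hX : X.IsOpenDensitySpace)
    {F : (X.Ω → ℝ) → ℝ} {K : (X.Ω → ℝ) → X.Cotangent} (hF : IsFirstVariation F K)
    {ρ : X.Ω → ℝ} {c : ℝ → X.Tangent} {s : ℝ} {v : X.Tangent}
    (hs : X.shift ρ (c s) ∈ X.densities)
    (hK : ContinuousAt (fun τ : X.Tangent => K (X.shift (X.shift ρ (c s)) τ)) 0)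
    (hc : HasDerivAt c v s) :
    HasDerivAt (fun t => F (X.shift ρ (c t))) (X.pairing (K (X.shift ρ (c s))) v) s := by
  rw [hasDerivAt_iff_tendsto_slope]
  have hK' := hK.tendsto
  rw [shift_zero] at hK'
  have := tendsto_mul_sub hX (l := 𝓝[≠] s) (F := fun _ => F) (K := fun _ => K) (fun _ => hF) hs
    hc.tendsto_sub_nhdsNE hc.tendsto_inv_smul_sub (hK'.comp tendsto_fst)
  simpa only [shift_shift_sub, slope_fun_def, vsub_eq_sub, smul_eq_mul] using this

end Calculus

/-! ### Nondegeneracy of the pairing; bilinearity and symmetry of `A` -/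

section Nondegenerate

variable {G : (X.Ω → ℝ) → X.Tangent ≃ₗ[ℝ] X.Cotangent} {ρ : X.Ω → ℝ}

theorem IsMetricTensor.pairing_symm_comm (hG : IsMetricTensor G) (hρ : ρ ∈ X.densities)
    (Φ Ψ : X.Cotangent) :
    X.pairing Φ ((G ρ).symm Ψ) = X.pairing Ψ ((G ρ).symm Φ) := by
  simpa using hG.symm ρ hρ ((G ρ).symm Φ) ((G ρ).symm Ψ)

theorem IsMetricTensor.tangent_ext (hG : IsMetricTensor G) (hρ : ρ ∈ X.densities)
    {σ τ : X.Tangent} (h : ∀ Φ : X.Cotangent, X.pairing Φ σ = X.pairing Φ τ) : σ = τ := by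
  by_contra hne
  have := hG.pos ρ hρ (σ - τ) (sub_ne_zero.2 hne)
  rw [map_sub (X.pairing _), h, sub_self] at this
  exact lt_irrefl _ this

/-- Symmetry of `G(ρ)⁻¹` transfers the test to tangent vectors, where positivity separates points.
-/
theorem IsMetricTensor.cotangent_ext (hG : IsMetricTensor G) (hρ : ρ ∈ X.densities)
    {Φ Ψ : X.Cotangent} (h : ∀ σ : X.Tangent, X.pairing Φ σ = X.pairing Ψ σ) : Φ = Ψ := by
  refine (G ρ).symm.injective (hG.tangent_ext hρ fun Θ => ?_)
  rw [hG.pairing_symm_comm hρ, h, hG.pairing_symm_comm hρ]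

variable {A : (X.Ω → ℝ) → X.Cotangent → X.Cotangent → X.Cotangent}

theorem HasFirstVariationAt.unique (hG : IsMetricTensor G) (hρ : ρ ∈ X.densities)
    {F : (X.Ω → ℝ) → ℝ} {Φ Ψ : X.Cotangent} (hΦ : HasFirstVariationAt F Φ ρ)
    (hΨ : HasFirstVariationAt F Ψ ρ) : Φ = Ψ :=
  hG.cotangent_ext hρ fun σ => (hΦ σ).unique (hΨ σ)

theorem IsMetricVariation.isLinearMap_right (hG : IsMetricTensor G) (hA : IsMetricVariation G A)
    (hρ : ρ ∈ X.densities) (Φ : X.Cotangent) : IsLinearMap ℝ (A ρ Φ) where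
  map_add Ψ₁ Ψ₂ := by
    refine (hA ρ hρ Φ (Ψ₁ + Ψ₂)).unique hG hρ fun σ => ?_
    simpa using (hA ρ hρ Φ Ψ₁ σ).fun_add (hA ρ hρ Φ Ψ₂ σ)
  map_smul a Ψ := by
    refine (hA ρ hρ Φ (a • Ψ)).unique hG hρ fun σ => ?_
    simpa using (hA ρ hρ Φ Ψ σ).const_mul a

theorem IsMetricVariation.isLinearMap_left (hG : IsMetricTensor G) (hA : IsMetricVariation G A)
    (hρ : ρ ∈ X.densities) (Φ : X.Cotangent) : IsLinearMap ℝ (fun Ψ => A ρ Ψ Φ) where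
  map_add Ψ₁ Ψ₂ := by
    refine (hA ρ hρ (Ψ₁ + Ψ₂) Φ).unique hG hρ fun σ => ?_
    simpa using (hA ρ hρ Ψ₁ Φ σ).fun_add (hA ρ hρ Ψ₂ Φ σ)
  map_smul a Ψ := by
    refine (hA ρ hρ (a • Ψ) Φ).unique hG hρ fun σ => ?_
    simpa using (hA ρ hρ Ψ Φ σ).const_mul a

theorem IsMetricVariation.symm [TopologicalSpace X.Tangent] [TopologicalSpace X.Cotangent]
    [ContinuousSMul ℝ X.Tangent] (hX : X.IsOpenDensitySpace)
    (hG : IsMetricTensor G) (hA : IsMetricVariation G A)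
    (hρ : ρ ∈ X.densities) (Φ Ψ : X.Cotangent) : A ρ Φ Ψ = A ρ Ψ Φ := by
  refine (hA ρ hρ Φ Ψ).unique hG hρ fun σ => ?_
  refine (hA ρ hρ Ψ Φ σ).congr_of_eventuallyEq ?_
  -- `G` is symmetric only at densities; openness ensures that `ρ + εσ` is one for small `ε`.
  have h0 : Tendsto (fun ε : ℝ => ε • σ) (𝓝 0) (𝓝 0) := by
    simpa using (tendsto_id (x := 𝓝 (0 : ℝ))).smul_const σ
  filter_upwards [h0 ((hX.isOpen ρ hρ).mem_nhds (by simpa [shift_zero] using hρ))] with ε hε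
  exact hG.pairing_symm_comm hε Φ Ψ

end Nondegenerate

/-! ### Second derivatives along geodesics -/

section Hessian

variable {G : (X.Ω → ℝ) → X.Tangent ≃ₗ[ℝ] X.Cotangent}
  {A : (X.Ω → ℝ) → X.Cotangent → X.Cotangent → X.Cotangent}
  {E : (X.Ω → ℝ) → ℝ} {D : (X.Ω → ℝ) → X.Cotangent}
  {S : (X.Ω → ℝ) → X.Tangent →ₗ[ℝ] X.Cotangent} {ρ : X.Ω → ℝ}

theorem hasDerivAt_pairing_left [TopologicalSpace X.Tangent] [TopologicalSpace X.Cotangent]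
    [IsTopologicalAddGroup X.Cotangent] [ContinuousSMul ℝ X.Cotangent]
    (hX : X.IsOpenDensitySpace) {Φ : ℝ → X.Cotangent}
    {Ψ : X.Cotangent} {s : ℝ} (hΦ : HasDerivAt Φ Ψ s) (σ : X.Tangent) :
    HasDerivAt (fun t => X.pairing (Φ t) σ) (X.pairing Ψ σ) s := by
  rw [hasDerivAt_iff_tendsto_slope]
  refine ((hX.continuous_pairing.comp (Continuous.prodMk_left σ)).tendsto Ψ |>.comp
    hΦ.tendsto_inv_smul_sub).congr fun t => ?_
  simp [slope_def_module]

section Geodesic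

variable [TopologicalSpace X.Tangent] [IsTopologicalAddGroup X.Tangent]
  [ContinuousSMul ℝ X.Tangent] [TopologicalSpace X.Cotangent]

theorem hasDerivAt_pairing_right (hX : X.IsOpenDensitySpace) {c : ℝ → X.Tangent}
    {σ : X.Tangent} {s : ℝ} (hc : HasDerivAt c σ s) (Φ : X.Cotangent) :
    HasDerivAt (fun t => X.pairing Φ (c t)) (X.pairing Φ σ) s := by
  rw [hasDerivAt_iff_tendsto_slope]
  refine ((hX.continuous_pairing.comp (Continuous.prodMk_right Φ)).tendsto σ |>.comp
    hc.tendsto_inv_smul_sub).congr fun t => ?_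
  simp [slope_def_module]

variable [IsTopologicalAddGroup X.Cotangent] [ContinuousSMul ℝ X.Cotangent]

/-- The derivative of `s ↦ ∫ δE/δρ(ρₛ) vₛ dx` along a curve with velocity field
`vₛ = G(ρₛ)⁻¹ Φₛ`. -/
theorem hasDerivAt_pairing_velocity (hX : X.IsOpenDensitySpace) (hG : IsMetricTensor G)
    (hA : IsMetricVariation G A) (hGA : IsC1Metric G A) (hS : IsSecondVariation D S)
    (hDS : IsC2Functional D S) (hρ : ρ ∈ X.densities) {c : ℝ → X.Tangent}
    {Φ : ℝ → X.Cotangent} {Ψ : X.Cotangent} (hc0 : c 0 = 0)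
    (hc : HasDerivAt c ((G ρ).symm (Φ 0)) 0) (hΦ : HasDerivAt Φ Ψ 0) :
    HasDerivAt (fun s => X.pairing (D (X.shift ρ (c s))) ((G (X.shift ρ (c s))).symm (Φ s)))
      (X.pairing (S ρ ((G ρ).symm (Φ 0))) ((G ρ).symm (Φ 0))
        + X.pairing (A ρ (D ρ) (Φ 0)) ((G ρ).symm (Φ 0)) + X.pairing Ψ ((G ρ).symm (D ρ))) 0 := by
  have hc_lim : Tendsto c (𝓝[≠] 0) (𝓝 0) := by simpa [hc0] using hc.tendsto_sub_nhdsNE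
  have hr : Tendsto (fun s => s⁻¹ • c s) (𝓝[≠] 0) (𝓝 ((G ρ).symm (Φ 0))) := by
    simpa [hc0] using hc.tendsto_inv_smul_sub
  have hΦ_lim : Tendsto Φ (𝓝[≠] 0) (𝓝 (Φ 0)) := by
    simpa using hΦ.tendsto_sub_nhdsNE.add_const (Φ 0)
  have hv_lim : Tendsto (fun s => (G (X.shift ρ (c s))).symm (Φ s)) (𝓝[≠] 0)
      (𝓝 ((G ρ).symm (Φ 0))) := by
    have := (hGA.continuous_inv ρ hρ (Φ 0)).tendsto.comp (hc_lim.prodMk_nhds hΦ_lim)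
    simpa only [shift_zero, Function.comp_def] using this
  -- Only the density in `D` moves; the velocity stays frozen at its value at time `s`, so the
  -- functional itself depends on `s`.
  have hfirst := tendsto_mul_sub hX (l := 𝓝[≠] (0 : ℝ))
    (F := fun s ρ' => X.pairing (D ρ') ((G (X.shift ρ (c s))).symm (Φ s)))
    (K := fun s ρ' => S ρ' ((G (X.shift ρ (c s))).symm (Φ s)))
    (fun s ρ' hρ' => hS ρ' hρ' _) hρ hc_lim hr (k := S ρ ((G ρ).symm (Φ 0))) (by
      have := (hDS.continuous_second ρ hρ ((G ρ).symm (Φ 0))).tendsto.comp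
        (tendsto_fst.prodMk_nhds (hv_lim.comp tendsto_snd))
      simpa only [shift_zero, Function.comp_def] using this)
  have hsecond := tendsto_mul_sub hX (l := 𝓝[≠] (0 : ℝ))
    (F := fun s ρ' => X.pairing (D ρ) ((G ρ').symm (Φ s)))
    (K := fun s ρ' => A ρ' (D ρ) (Φ s))
    (fun s ρ' hρ' => hA ρ' hρ' _ _) hρ hc_lim hr (k := A ρ (D ρ) (Φ 0)) (by
      have := (hGA.continuous_variation ρ hρ (D ρ) (Φ 0)).tendsto.comp
        (tendsto_fst.prodMk_nhds (tendsto_const_nhds.prodMk_nhds (hΦ_lim.comp tendsto_snd)))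
      simpa only [shift_zero, Function.comp_def] using this)
  have hthird := hasDerivAt_iff_tendsto_slope.1
    (hasDerivAt_pairing_left hX hΦ ((G ρ).symm (D ρ)))
  rw [hasDerivAt_iff_tendsto_slope]
  -- The three increments telescope once symmetry rewrites `∫ D(ρ) G(ρ)⁻¹Φ` as `∫ Φ G(ρ)⁻¹D(ρ)`.
  refine ((hfirst.add hsecond).add hthird).congr fun s => ?_
  simp only [slope_def_module, sub_zero, hc0, shift_zero, smul_eq_mul,
    hG.pairing_symm_comm hρ _ (D ρ)]
  ring

theorem IsGeodesicFrom.hasSecondDerivAtZero (hX : X.IsOpenDensitySpace) (hG : IsMetricTensor G)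
    (hA : IsMetricVariation G A) (hGA : IsC1Metric G A) (hD : IsFirstVariation E D)
    (hS : IsSecondVariation D S) (hDS : IsC2Functional D S) (hρ : ρ ∈ X.densities)
    {σ : X.Tangent} {c : ℝ → X.Tangent} (hgeo : IsGeodesicFrom G ρ σ c) :
    HasSecondDerivAtZero (fun s => E (X.shift ρ (c s))) (hessianFormula G A D S ρ (G ρ σ)) := by
  obtain ⟨hc0, hcσ, Φ, hev⟩ := hgeo
  obtain ⟨-, hc, B, hB, hΦ⟩ := hev.self_of_nhds
  rw [hc0, shift_zero] at hc hB
  -- The two derivatives of `c` at `0` are compared after pairing, as real derivatives, so no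
  -- separation axiom on the tangent space is needed.
  have hσ : (G ρ).symm (Φ 0) = σ := hG.tangent_ext hρ fun Θ =>
    (hasDerivAt_pairing_right hX hc Θ).unique (hasDerivAt_pairing_right hX hcσ Θ)
  have hΦσ : Φ 0 = G ρ σ := by rw [← hσ, LinearEquiv.apply_symm_apply]
  have hBA : B = A ρ (Φ 0) (Φ 0) := hB.unique hG hρ (hA ρ hρ _ _)
  have hderiv : ∀ᶠ s in 𝓝 (0 : ℝ), HasDerivAt (fun t => E (X.shift ρ (c t)))
      (X.pairing (D (X.shift ρ (c s))) ((G (X.shift ρ (c s))).symm (Φ s))) s := by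
    filter_upwards [hev] with s hs
    exact hasDerivAt_comp_shift hX hD hs.1 (hDS.continuous_first _ hs.1) hs.2.1
  refine ⟨hderiv.mono fun s hs => hs.differentiableAt, ?_⟩
  have hmain := hasDerivAt_pairing_velocity hX hG hA hGA hS hDS hρ hc0 hc hΦ
  refine (hmain.congr_of_eventuallyEq (hderiv.mono fun s hs => hs.deriv)).congr_deriv ?_
  simp only [hessianFormula, ← hΦσ, hBA, hA.symm hX hG hρ (D ρ) (Φ 0), map_neg, map_smul,
    LinearMap.neg_apply, LinearMap.smul_apply, smul_eq_mul]
  ring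

theorem HasSecondDerivAtZero.unique {f : ℝ → ℝ} {v w : ℝ} (hv : HasSecondDerivAtZero f v)
    (hw : HasSecondDerivAtZero f w) : v = w :=
  hv.2.unique hw.2

end Geodesic

/-! ### The operator on cotangent vectors -/

theorem isCotangentHessian_comp_symm {L : X.Tangent →ₗ[ℝ] X.Tangent}
    (hG : IsMetricTensor G) (hρ : ρ ∈ X.densities)
    (hL : ∀ σ τ : X.Tangent, metric G ρ (L σ) τ = metric G ρ σ (L τ)) :
    IsCotangentHessian G ρ L (L ∘ₗ (G ρ).symm.toLinearMap) where
  selfAdjoint Φ Ψ := by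
    have h := hL ((G ρ).symm Ψ) ((G ρ).symm Φ)
    simp only [metric, LinearEquiv.apply_symm_apply] at h
    rw [hG.symm ρ hρ, LinearEquiv.apply_symm_apply] at h
    simpa using h
  quadratic σ Φ h := by
    subst h
    simp [metric, hG.symm ρ hρ (L σ) σ]

/-- Since `G(ρ)` is onto, the quadratic form is prescribed on all cotangent vectors; polarization
with self-adjointness recovers the bilinear form, and nondegeneracy the operator. -/
theorem IsCotangentHessian.unique {L : X.Tangent →ₗ[ℝ] X.Tangent}
    {H H' : X.Cotangent →ₗ[ℝ] X.Tangent} (hG : IsMetricTensor G) (hρ : ρ ∈ X.densities)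
    (hH : IsCotangentHessian G ρ L H) (hH' : IsCotangentHessian G ρ L H') : H = H' := by
  have hq : ∀ Φ, X.pairing Φ (H Φ) = X.pairing Φ (H' Φ) := fun Φ => by
    have hΦ : Φ = G ρ ((G ρ).symm Φ) := by simp
    rw [hH.quadratic _ Φ hΦ, hH'.quadratic _ Φ hΦ]
  refine LinearMap.ext fun Ψ => hG.tangent_ext hρ fun Φ => ?_
  have h := hq (Φ + Ψ)
  simp only [map_add, LinearMap.add_apply, hq Φ, hq Ψ, hH.selfAdjoint Ψ Φ,
    hH'.selfAdjoint Ψ Φ] at h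
  linarith

end Hessian

end DensitySpace

theorem mainTheorem4 {d : ℕ} (X : DensitySpace d)
    [TopologicalSpace X.Tangent] [IsTopologicalAddGroup X.Tangent] [ContinuousSMul ℝ X.Tangent]
    [TopologicalSpace X.Cotangent] [IsTopologicalAddGroup X.Cotangent]
    [ContinuousSMul ℝ X.Cotangent]
    (hX : X.IsOpenDensitySpace)
    (G : (X.Ω → ℝ) → X.Tangent ≃ₗ[ℝ] X.Cotangent) (hG : DensitySpace.IsMetricTensor G)
    (A : (X.Ω → ℝ) → X.Cotangent → X.Cotangent → X.Cotangent)
    (hA : DensitySpace.IsMetricVariation G A) (hGA : DensitySpace.IsC1Metric G A)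
    (E : (X.Ω → ℝ) → ℝ) (D : (X.Ω → ℝ) → X.Cotangent)
    (S : (X.Ω → ℝ) → X.Tangent →ₗ[ℝ] X.Cotangent)
    (hD : DensitySpace.IsFirstVariation E D) (hS : DensitySpace.IsSecondVariation D S)
    (hDS : DensitySpace.IsC2Functional D S)
    (ρ : X.Ω → ℝ) (hρ : ρ ∈ X.densities) :
    -- `A(ρ)` is bilinear
    ((∀ Φ : X.Cotangent, IsLinearMap ℝ (A ρ Φ)) ∧
      (∀ Φ : X.Cotangent, IsLinearMap ℝ (fun Ψ => A ρ Ψ Φ))) ∧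
    -- the second derivative of `E` along every geodesic exists and is given by the formula
    (∀ (σ : X.Tangent) (c : ℝ → X.Tangent), DensitySpace.IsGeodesicFrom G ρ σ c →
      DensitySpace.HasSecondDerivAtZero (fun s => E (X.shift ρ (c s)))
        (DensitySpace.hessianFormula G A D S ρ (G ρ σ))) ∧
    -- the operators `L = Hess E(ρ)` and `H = 𝓗_E(ρ)`
    ((∀ σ : X.Tangent, ∃ c : ℝ → X.Tangent, DensitySpace.IsGeodesicFrom G ρ σ c) →
      ∀ L : X.Tangent →ₗ[ℝ] X.Tangent, DensitySpace.IsHessian G E ρ L →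
        (∃! H : X.Cotangent →ₗ[ℝ] X.Tangent, DensitySpace.IsCotangentHessian G ρ L H) ∧
        ∀ H : X.Cotangent →ₗ[ℝ] X.Tangent, DensitySpace.IsCotangentHessian G ρ L H →
          (∀ (σ : X.Tangent) (Φ : X.Cotangent), Φ = G ρ σ →
            X.pairing Φ (H Φ) = DensitySpace.metric G ρ σ (L σ) ∧
            DensitySpace.metric G ρ σ (L σ) = DensitySpace.hessianFormula G A D S ρ Φ) ∧
          H = L ∘ₗ (G ρ).symm.toLinearMap) := by
  refine ⟨⟨hA.isLinearMap_right hG hρ, hA.isLinearMap_left hG hρ⟩,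
    fun σ c hc => hc.hasSecondDerivAtZero hX hG hA hGA hD hS hDS hρ, fun hex L hL => ?_⟩
  have hcomp := DensitySpace.isCotangentHessian_comp_symm hG hρ hL.selfAdjoint
  refine ⟨⟨_, hcomp, fun H hH => hH.unique hG hρ hcomp⟩,
    fun H hH => ⟨fun σ Φ hΦ => ⟨hH.quadratic σ Φ hΦ, ?_⟩, hH.unique hG hρ hcomp⟩⟩
  obtain ⟨c, hc⟩ := hex σ
  subst hΦ
  exact (hL.secondDeriv σ c hc).unique (hc.hasSecondDerivAtZero hX hG hA hGA hD hS hDS hρ)
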